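/- Let $d\ge n\ge 1$, let $X\in\mathbb R^{n\times d}$ have full row rank $n$, and let $\pi$ be a probability distribution on $\mathbb R^d$ with finite second moment $\int\|\theta\|^2\,d\pi(\theta)<\infty$ and with a positive and differentiable density, such that the distribution of $X\theta$, $\theta\sim\pi$, also has a positive and differentiable density $p$ on $\mathbb R^n$. Put $$\mathsf J_\pi=\mathbb E_{\theta\sim\pi}\Big[\tfrac1n\|\nabla\log p(X\theta)\|^2\Big],\qquad \mathsf V_\pi=\mathbb E_{\theta\sim\pi}\Big[\tfrac1n\|X\theta\|^2\Big],$$ and assume $\mathsf J_\pi<\infty$. Let $\Sigma\in\mathbb R^{d\times d}$ be symmetric positive definite, $\|v\|_\Sigma^2=v^\top\Sigma v$, and $\lambda_\Sigma=\frac1n\|X\Sigma^{-1/2}\|^2$ (spectral norm). For $\sigma>0$ let $y=X\theta+\sigma\tau$, where $\theta\sim\pi$ and $\tau\sim N(0,I_n)$ are independent. An estimator is a map $\hat\theta:\mathbb R^n\to\mathbb R^d$ that is square-integrable with respect to the law of $y$; write $$\mathsf{Train}(\hat\theta)=\mathbb E\Big[\tfrac1n\|X\hat\theta(y)-y\|^2\Big],\quad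 \mathsf{Pred}_\Sigma(\hat\theta)=\mathbb E\big[\|\hat\theta(y)-\theta\|_\Sigma^2\big],\quad \mathsf{Cost}_\Sigma(\hat\theta)=\mathsf{Pred}_\Sigma(\hat\theta)-\inf_{\tilde\theta}\mathsf{Pred}_\Sigma(\tilde\theta),$$ the infimum being over all estimators $\tilde\theta$. Then, for every $\sigma>0$ and every estimator $\hat\theta$: (i) if $\mathsf{Train}(\hat\theta)\ge \dfrac{\sigma^4}{\mathsf J_\pi^{-1}+\sigma^2}$, then $\mathsf{Cost}_\Sigma(\hat\theta)\ge\lambda_\Sigma^{-1}\left(\sqrt{\mathsf{Train}(\hat\theta)}-\sqrt{\dfrac{\sigma^4}{\mathsf J_\pi^{-1}+\sigma^2}}\right)^2$; (ii) if $\mathsf{Train}(\hat\theta)\le \dfrac{\sigma^4}{\mathsf V_\pi+\sigma^2}$, then $\mathsf{Cost}_\Sigma(\hat\theta)\ge\lambda_\Sigma^{-1}\left(\sqrt{\dfrac{\sigma^4}{\mathsf V_\pi+\sigma^2}}-\sqrt{\mathsf{Train}(\hat\theta)}\right)^2$. -/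

import Mathlib

open MeasureTheory ProbabilityTheory
open scoped Matrix

noncomputable section

namespace BayesLinearModel

variable {n d : ℕ}

/-- The observed response `y = X θ + σ τ`, as a function of the pair `(θ, τ)`. -/
def response (X : Matrix (Fin n) (Fin d) ℝ) (σ : ℝ)
    (ω : EuclideanSpace ℝ (Fin d) × EuclideanSpace ℝ (Fin n)) : EuclideanSpace ℝ (Fin n) :=
  X.toEuclideanLin ω.1 + σ • ω.2

/-- The law of the pair `(θ, τ)` in the Bayesian linear model: `θ ∼ π` and `τ ∼ N(0, I_n)` are
independent. -/
def jointLaw (n : ℕ) (π : Measure (EuclideanSpace ℝ (Fin d))) :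
    Measure (EuclideanSpace ℝ (Fin d) × EuclideanSpace ℝ (Fin n)) :=
  π.prod (stdGaussian (EuclideanSpace ℝ (Fin n)))

/-- The law of the observed response `y`. -/
def responseLaw (X : Matrix (Fin n) (Fin d) ℝ) (π : Measure (EuclideanSpace ℝ (Fin d))) (σ : ℝ) :
    Measure (EuclideanSpace ℝ (Fin n)) :=
  (jointLaw n π).map (response X σ)

/-- An estimator of `θ` (for a given design `X`) is a map `y ↦ g y`, square-integrable with respect
to the law of the observed response. -/
def IsEstimator (X : Matrix (Fin n) (Fin d) ℝ) (π : Measure (EuclideanSpace ℝ (Fin d))) (σ : ℝ)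
    (g : EuclideanSpace ℝ (Fin n) → EuclideanSpace ℝ (Fin d)) : Prop :=
  MemLp g 2 (responseLaw X π σ)

/-- Expected training error `E[(1/n) ‖X θ̂(y) - y‖²]`. -/
def trainError (X : Matrix (Fin n) (Fin d) ℝ) (π : Measure (EuclideanSpace ℝ (Fin d))) (σ : ℝ)
    (g : EuclideanSpace ℝ (Fin n) → EuclideanSpace ℝ (Fin d)) : ℝ :=
  ∫ ω, (1 / (n : ℝ)) * ‖X.toEuclideanLin (g (response X σ ω)) - response X σ ω‖ ^ 2
    ∂(jointLaw n π)

/-- The squared seminorm `‖v‖_Σ² = vᵀ Σ v`. -/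
def sqNorm (S : Matrix (Fin d) (Fin d) ℝ) (v : EuclideanSpace ℝ (Fin d)) : ℝ :=
  v.ofLp ⬝ᵥ (S *ᵥ v.ofLp)

/-- Prediction error `E[‖θ̂(y) - θ‖_Σ²]`. -/
def predError (X : Matrix (Fin n) (Fin d) ℝ) (π : Measure (EuclideanSpace ℝ (Fin d))) (σ : ℝ)
    (S : Matrix (Fin d) (Fin d) ℝ)
    (g : EuclideanSpace ℝ (Fin n) → EuclideanSpace ℝ (Fin d)) : ℝ :=
  ∫ ω, sqNorm S (g (response X σ ω) - ω.1) ∂(jointLaw n π)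

/-- The optimal prediction error: the infimum of the prediction error over all estimators. -/
def optPredError (X : Matrix (Fin n) (Fin d) ℝ) (π : Measure (EuclideanSpace ℝ (Fin d))) (σ : ℝ)
    (S : Matrix (Fin d) (Fin d) ℝ) : ℝ :=
  sInf (predError X π σ S '' {g | IsEstimator X π σ g})

/-- Excess prediction error. -/
def cost (X : Matrix (Fin n) (Fin d) ℝ) (π : Measure (EuclideanSpace ℝ (Fin d))) (σ : ℝ)
    (S : Matrix (Fin d) (Fin d) ℝ)
    (g : EuclideanSpace ℝ (Fin n) → EuclideanSpace ℝ (Fin d)) : ℝ :=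
  predError X π σ S g - optPredError X π σ S

/-- `(1/n) ‖∇ log p(X θ)‖²`, for a density `p` of `X θ`. -/
def scoreSq (X : Matrix (Fin n) (Fin d) ℝ) (p : EuclideanSpace ℝ (Fin n) → ℝ)
    (θ : EuclideanSpace ℝ (Fin d)) : ℝ :=
  (1 / (n : ℝ)) * ‖gradient (fun y => Real.log (p y)) (X.toEuclideanLin θ)‖ ^ 2

/-- The Fisher information parameter `E[(1/n) ‖∇ log p(X θ)‖²]`, where `p` is the density of
`X θ`. -/
def fisherInfo (X : Matrix (Fin n) (Fin d) ℝ) (π : Measure (EuclideanSpace ℝ (Fin d)))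
    (p : EuclideanSpace ℝ (Fin n) → ℝ) : ℝ :=
  ∫ θ, scoreSq X p θ ∂π

/-- The variance parameter `E[(1/n) ‖X θ‖²]`. -/
def varParam (X : Matrix (Fin n) (Fin d) ℝ) (π : Measure (EuclideanSpace ℝ (Fin d))) : ℝ :=
  ∫ θ, (1 / (n : ℝ)) * ‖X.toEuclideanLin θ‖ ^ 2 ∂π

/-- The spectral norm of a real matrix (operator norm between Euclidean spaces). -/
def specNorm {m k : ℕ} (A : Matrix (Fin m) (Fin k) ℝ) : ℝ :=
  ‖LinearMap.toContinuousLinearMap A.toEuclideanLin‖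

open scoped MatrixOrder in
/-- `λ_Σ = (1/n) ‖X Σ^{-1/2}‖²`, with the positive semidefinite square root and the spectral
norm. -/
def lambda (X : Matrix (Fin n) (Fin d) ℝ) (S : Matrix (Fin d) (Fin d) ℝ) : ℝ :=
  (1 / (n : ℝ)) * specNorm (X * (CFC.sqrt S)⁻¹) ^ 2

end BayesLinearModel

end

/-!
Write `μ` for the law of the signal `X θ` and `h(y) = E[θ | y]` for the posterior mean.

Since `h` is the `L²` projection of `θ` on functions of `y`, the excess prediction error of an
estimator `g` is at least `E ‖g(y) - h(y)‖_Σ²`, and `(1/n) ‖X v‖² ≤ λ_Σ ‖v‖_Σ²`. The reverse triangle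
inequality in `L²` applied to the training residuals of `g` and `h` then gives
`λ_Σ⁻¹ (√Train(g) - √Train(h))² ≤ Cost(g)` (`mul_sq_sqrt_trainError_sub_le_cost`). It remains to show
`σ⁴ / (V + σ²) ≤ Train(h) ≤ σ⁴ / (J⁻¹ + σ²)`.

The residual `r(y) = X h(y) - y` of the posterior mean equals `-σ E[τ | y]`
(`integral_inner_residual`); by Tweedie's formula it is `σ²` times the score of the law of `y`, so the
two bounds amount to the Cramér–Rao and the Blachman–Stam inequality for that law. They are obtained
without ever differentiating the density of `y`:

* pairing `r(y)` with `y` and using Cauchy–Schwarz gives the lower bound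
  (`le_trainError_of_isPosteriorMean`);
* integrating by parts once in `θ` and once in `τ` shows that `s(X θ)`, with `s = ∇ log p`, and
  `-τ / σ` have the same conditional expectation given `y`
  (`integral_inner_score_add_snd_eq_zero`). Hence `r(y) = E[a σ² s(X θ) - b σ τ | y]` whenever
  `a + b = 1`, and Cauchy–Schwarz with the optimal weights gives the upper bound
  (`trainError_le_of_isPosteriorMean`).

Conditional expectations given `y` are realised through the adjoint of the isometric embedding
`k ↦ k ∘ y` of `L²(law of y)` (`exists_memLp_integral_inner_comp_eq`), and equality of two of them is
tested against smooth compactly supported functions of `y`.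
-/

namespace BayesLinearModel
open scoped RealInnerProductSpace

/-! ### Inner products and conditional expectations in `L²` -/

section L2

variable {Ω : Type*} [MeasurableSpace Ω] {P : Measure Ω}
  {E : Type*} [NormedAddCommGroup E] [InnerProductSpace ℝ E]

lemma integrable_inner_of_memLp {u v : Ω → E} (hu : MemLp u 2 P) (hv : MemLp v 2 P) :
    Integrable (fun ω => ⟪u ω, v ω⟫) P := by
  refine (L2.integrable_inner (𝕜 := ℝ) hu.toLp hv.toLp).congr ?_
  filter_upwards [hu.coeFn_toLp, hv.coeFn_toLp] with ω h1 h2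
  rw [h1, h2]

lemma inner_toLp {u v : Ω → E} (hu : MemLp u 2 P) (hv : MemLp v 2 P) :
    ⟪hu.toLp, hv.toLp⟫ = ∫ ω, ⟪u ω, v ω⟫ ∂P := by
  rw [L2.inner_def]
  refine integral_congr_ae ?_
  filter_upwards [hu.coeFn_toLp, hv.coeFn_toLp] with ω h1 h2
  rw [h1, h2]

lemma norm_toLp_eq_sqrt {u : Ω → E} (hu : MemLp u 2 P) :
    ‖hu.toLp‖ = √(∫ ω, ‖u ω‖ ^ 2 ∂P) := by
  rw [norm_eq_sqrt_real_inner, inner_toLp]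
  simp_rw [real_inner_self_eq_norm_sq]

/-- Cauchy–Schwarz in `L²(P; E)`. -/
lemma sq_integral_inner_le {u v : Ω → E} (hu : MemLp u 2 P) (hv : MemLp v 2 P) :
    (∫ ω, ⟪u ω, v ω⟫ ∂P) ^ 2 ≤ (∫ ω, ‖u ω‖ ^ 2 ∂P) * ∫ ω, ‖v ω‖ ^ 2 ∂P := by
  have h := real_inner_mul_inner_self_le hu.toLp hv.toLp
  simp only [inner_toLp] at h
  simp only [real_inner_self_eq_norm_sq] at h
  rwa [sq]

/-- Reverse triangle inequality in `L²(P; E)`. -/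
lemma sq_sqrt_integral_sub_le {u v : Ω → E} (hu : MemLp u 2 P) (hv : MemLp v 2 P) :
    (√(∫ ω, ‖u ω‖ ^ 2 ∂P) - √(∫ ω, ‖v ω‖ ^ 2 ∂P)) ^ 2 ≤ ∫ ω, ‖u ω - v ω‖ ^ 2 ∂P := by
  have h := abs_norm_sub_norm_le hu.toLp hv.toLp
  rw [← MemLp.toLp_sub, norm_toLp_eq_sqrt, norm_toLp_eq_sqrt, norm_toLp_eq_sqrt] at h
  have h2 := Real.sq_sqrt (integral_nonneg (μ := P) fun ω => sq_nonneg ‖(u - v) ω‖)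
  rw [← sq_abs]
  refine (pow_le_pow_left₀ (abs_nonneg _) h 2).trans h2.le

/-- The conditional expectation `h(Y) = E[u | Y]`, characterised by its orthogonality relation. It is
the image of `u` under the adjoint of the isometry `k ↦ k ∘ Y` of `L²(law Y)` into `L²(P)`. -/
lemma exists_memLp_integral_inner_comp_eq [CompleteSpace E]
    {F : Type*} [MeasurableSpace F] {Y : Ω → F}
    (hY : Measurable Y) {u : Ω → E} (hu : MemLp u 2 P) :
    ∃ h : F → E, MemLp h 2 (P.map Y) ∧ ∀ k : F → E, MemLp k 2 (P.map Y) →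
      ∫ ω, ⟪u ω, k (Y ω)⟫ ∂P = ∫ ω, ⟪h (Y ω), k (Y ω)⟫ ∂P := by
  have hYm : MeasurePreserving Y P (P.map Y) := ⟨hY, rfl⟩
  let T := (Lp.compMeasurePreservingₗᵢ (E := E) (p := 2) ℝ Y hYm).toContinuousLinearMap
  refine ⟨ContinuousLinearMap.adjoint T hu.toLp, Lp.memLp _, fun k hk => ?_⟩
  have hkY : MemLp (fun ω => k (Y ω)) 2 P := hk.comp_measurePreserving hYm
  have hT : T hk.toLp = hkY.toLp := Lp.toLp_compMeasurePreserving hk hYm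
  have h1 : ⟪ContinuousLinearMap.adjoint T hu.toLp, hk.toLp⟫ = ∫ ω, ⟪u ω, k (Y ω)⟫ ∂P := by
    rw [ContinuousLinearMap.adjoint_inner_left, hT, inner_toLp hu hkY]
  rw [← h1, ← Lp.toLp_coeFn (ContinuousLinearMap.adjoint T hu.toLp) (Lp.memLp _), inner_toLp,
    Lp.toLp_coeFn, integral_map hY.aemeasurable]
  exact ((Lp.memLp _).aestronglyMeasurable.inner hk.aestronglyMeasurable)

end L2

/-! ### Scores and integration by parts -/

section Score

variable {E : Type*} [NormedAddCommGroup E] [InnerProductSpace ℝ E] [MeasurableSpace E]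

/-- `s` is the score (logarithmic gradient) of `μ`, in the weak sense: integration by parts
`∫ φ ⟪s, v⟫ ∂μ = -∫ ∂ᵥφ ∂μ` holds for compactly supported `C¹` functions `φ`. -/
def IsScore (μ : Measure E) (s : E → E) : Prop :=
  ∀ φ : E → ℝ, ContDiff ℝ 1 φ → HasCompactSupport φ → ∀ v : E,
    ∫ x, φ x * ⟪s x, v⟫ ∂μ = -∫ x, fderiv ℝ φ x v ∂μ

lemma measurable_gradient [CompleteSpace E] [BorelSpace E] (f : E → ℝ) : Measurable (gradient f) :=
  (InnerProductSpace.toDual ℝ E).symm.continuous.measurable.comp (measurable_fderiv ℝ f)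

variable [BorelSpace E]

/-- Only differentiability of the density is needed: integrability of `s` bounds its gradient `p • s`,
which need not be continuous. -/
lemma isScore_withDensity [FiniteDimensional ℝ E] {p : E → ℝ} {s : E → E} (hp : ∀ x, 0 ≤ p x)
    (hs : ∀ x, HasFDerivAt p (p x • innerSL ℝ (s x)) x)
    (hint : Integrable s (volume.withDensity fun x => ENNReal.ofReal (p x))) :
    IsScore (volume.withDensity fun x => ENNReal.ofReal (p x)) s := by
  intro φ hφ hφc v
  have hpc : Continuous p := continuous_iff_continuousAt.2 fun x => (hs x).continuousAt
  have hpm : Measurable fun x => ENNReal.ofReal (p x) := by fun_prop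
  have key : ∀ u : E → ℝ, ∫ x, u x ∂(volume.withDensity fun x => ENNReal.ofReal (p x))
      = ∫ x, p x * u x := fun u => by
    rw [integral_withDensity_eq_integral_toReal_smul hpm (by simp)]
    simp [ENNReal.toReal_ofReal (hp _)]
  rw [key, key]
  have hint' : Integrable (fun x => p x • s x) := by
    have := (integrable_withDensity_iff_integrable_smul' hpm (by simp)).1 hint
    simpa [ENNReal.toReal_ofReal (hp _)] using this
  obtain ⟨C, hC⟩ := hφc.exists_bound_of_continuous hφ.continuous
  have hI := integral_mul_fderiv_eq_neg_fderiv_mul_of_integrable (μ := (volume : Measure E))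
    (f := p) (g := φ) (v := v) ?_ ?_ ?_ (fun x _ => (hs x).differentiableAt)
    (fun x _ => (hφ.differentiable (by norm_num)) x)
  · rw [hI, neg_neg]
    refine integral_congr_ae (.of_forall fun x => ?_)
    simp only [(hs x).fderiv]
    simp
    ring
  · simp only [(hs _).fderiv]
    have h1 : Integrable (fun x => ⟪p x • s x, v⟫) := hint'.inner_const v
    refine (h1.mul_bdd hφ.continuous.aestronglyMeasurable (.of_forall hC)).congr
      (.of_forall fun x => ?_)
    simp [real_inner_smul_left]
  · have h1 : Continuous fun x => fderiv ℝ φ x v :=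
      (hφ.continuous_fderiv (by norm_num)).clm_apply continuous_const
    exact (hpc.mul h1).integrable_of_hasCompactSupport ((hφc.fderiv_apply ℝ v).mul_left)
  · exact (hpc.mul hφ.continuous).integrable_of_hasCompactSupport hφc.mul_left

lemma isScore_gradient_log [FiniteDimensional ℝ E] {p : E → ℝ} (hp : ∀ x, 0 < p x)
    (hd : Differentiable ℝ p)
    (hint : Integrable (gradient fun x => Real.log (p x))
      (volume.withDensity fun x => ENNReal.ofReal (p x))) :
    IsScore (volume.withDensity fun x => ENNReal.ofReal (p x))
      (gradient fun x => Real.log (p x)) := by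
  refine isScore_withDensity (fun x => (hp x).le) (fun x => ?_) hint
  have h : innerSL ℝ (gradient (fun x => Real.log (p x)) x) = (p x)⁻¹ • fderiv ℝ p x :=
    (toDual_gradient (𝕜 := ℝ) (f := fun x => Real.log (p x)) (x := x)).trans
      ((hd x).hasFDerivAt.log (hp x).ne').fderiv
  rw [h, smul_smul, mul_inv_cancel₀ (hp x).ne', one_smul]
  exact (hd x).hasFDerivAt

variable (E) [FiniteDimensional ℝ E]

/-- The density of the standard Gaussian law, identified through characteristic functions. -/
lemma stdGaussian_eq_withDensity :
    stdGaussian E = volume.withDensity fun x => ENNReal.ofReal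
      ((2 * Real.pi) ^ (-(Module.finrank ℝ E / 2 : ℝ)) * Real.exp (-(1 / 2) * ‖x‖ ^ 2)) := by
  set c : ℝ := (2 * Real.pi) ^ (-(Module.finrank ℝ E / 2 : ℝ)) with hc
  have hc0 : 0 < c := by positivity
  have hint : Integrable fun x : E => c * Real.exp (-(1 / 2) * ‖x‖ ^ 2) := by
    refine Integrable.const_mul ?_ c
    -- a non-integrable function would have integral `0`, but this Gaussian integral is positive
    by_contra hni
    have h := GaussianFourier.integral_rexp_neg_mul_sq_norm (V := E) (b := 1 / 2) (by norm_num)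
    rw [integral_undef hni] at h
    have : 0 < (Real.pi / (1 / 2)) ^ (Module.finrank ℝ E / 2 : ℝ) := by positivity
    exact this.ne h
  have hm : Measurable fun x : E => ENNReal.ofReal (c * Real.exp (-(1 / 2) * ‖x‖ ^ 2)) := by
    fun_prop
  have : IsFiniteMeasure (volume.withDensity fun x : E =>
      ENNReal.ofReal (c * Real.exp (-(1 / 2) * ‖x‖ ^ 2))) :=
    isFiniteMeasure_withDensity_ofReal hint.2
  refine Measure.ext_of_charFun ?_
  ext t
  rw [charFun_stdGaussian, charFun_apply, integral_withDensity_eq_integral_toReal_smul hm (by simp)]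
  have h := GaussianFourier.integral_cexp_neg_mul_sq_norm_add (V := E) (b := 1 / 2) (by norm_num)
    Complex.I t
  have h2 : ∀ x : E, (ENNReal.ofReal (c * Real.exp (-(1 / 2) * ‖x‖ ^ 2))).toReal •
      Complex.exp (⟪x, t⟫ * Complex.I)
      = c * Complex.exp (-(1 / 2) * ‖x‖ ^ 2 + Complex.I * ⟪t, x⟫) := fun x => by
    rw [ENNReal.toReal_ofReal (by positivity), Complex.exp_add, real_inner_comm, Complex.real_smul,
      mul_comm Complex.I]
    push_cast
    ring
  simp_rw [h2]
  rw [integral_const_mul, h]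
  have h3 : (Real.pi / (1 / 2) : ℂ) ^ (Module.finrank ℝ E / 2 : ℂ)
      = ((2 * Real.pi) ^ (Module.finrank ℝ E / 2 : ℝ) : ℝ) := by
    rw [Complex.ofReal_cpow (by positivity)]
    push_cast
    congr 1
    ring
  rw [h3, ← mul_assoc, ← Complex.ofReal_mul, hc, ← Real.rpow_add (by positivity)]
  simp
  ring_nf

/-- Gaussian integration by parts: the score of the standard Gaussian law is `x ↦ -x`. -/
lemma isScore_stdGaussian : IsScore (stdGaussian E) (fun x => -x) := by
  have hint : Integrable (fun x : E => -x) (stdGaussian E) := IsGaussian.integrable_id.neg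
  rw [stdGaussian_eq_withDensity] at hint ⊢
  refine isScore_withDensity (fun x => by positivity) (fun x => ?_) hint
  have h := ((((hasStrictFDerivAt_norm_sq x).hasFDerivAt.const_mul
    (-(1 / 2) : ℝ))).exp).const_mul ((2 * Real.pi) ^ (-(Module.finrank ℝ E / 2 : ℝ)))
  convert! h using 1
  ext v
  simp
  ring

lemma integral_norm_sq_stdGaussian : ∫ x, ‖x‖ ^ 2 ∂(stdGaussian E) = Module.finrank ℝ E := by
  let b := stdOrthonormalBasis ℝ E
  simp_rw [← b.sum_sq_inner_right]
  have hL : ∀ i, MemLp (fun x : E => innerSL ℝ (b i) x) 2 (stdGaussian E) := fun i =>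
    (innerSL ℝ (b i)).comp_memLp' (IsGaussian.memLp_two_id (μ := stdGaussian E))
  have hone : ∀ i, ∫ x, ⟪b i, x⟫ ^ 2 ∂(stdGaussian E) = 1 := fun i => by
    have h := variance_dual_stdGaussian (innerSL ℝ (b i) : StrongDual ℝ E)
    rw [variance_eq_sub (hL i), integral_strongDual_stdGaussian] at h
    simpa using h
  have hsq : ∀ i, Integrable (fun x : E => ⟪b i, x⟫ ^ 2) (stdGaussian E) := fun i =>
    (hL i).integrable_sq
  rw [integral_finsetSum _ fun i _ => hsq i]
  simp [hone]

end Score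

/-! ### Signal and noise -/

section Model

variable {n d : ℕ} {X : Matrix (Fin n) (Fin d) ℝ} {π : Measure (EuclideanSpace ℝ (Fin d))}
  {σ : ℝ}

lemma continuous_toEuclideanLin (X : Matrix (Fin n) (Fin d) ℝ) : Continuous X.toEuclideanLin :=
  LinearMap.continuous_of_finiteDimensional _

@[fun_prop]
lemma measurable_response : Measurable (response X σ) := by
  have := (continuous_toEuclideanLin X).measurable
  unfold response
  fun_prop

lemma memLp_comp_fst {E : Type*} [NormedAddCommGroup E] {u : EuclideanSpace ℝ (Fin d) → E}
    (hu : MemLp u 2 π) : MemLp (fun ω => u ω.1) 2 (jointLaw n π) :=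
  hu.comp_measurePreserving measurePreserving_fst

lemma measurePreserving_response :
    MeasurePreserving (response X σ) (jointLaw n π) (responseLaw X π σ) :=
  ⟨measurable_response, rfl⟩

lemma memLp_toEuclideanLin (hπ : MemLp id 2 π) : MemLp (fun θ => X.toEuclideanLin θ) 2 π :=
  (LinearMap.toContinuousLinearMap X.toEuclideanLin).comp_memLp' hπ

variable [IsProbabilityMeasure π]

instance : IsProbabilityMeasure (jointLaw n π) := by
  unfold jointLaw; infer_instance

lemma memLp_snd : MemLp (fun ω => ω.2) 2 (jointLaw n π) :=
  (IsGaussian.memLp_two_id (μ := stdGaussian (EuclideanSpace ℝ (Fin n)))).comp_measurePreserving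
    measurePreserving_snd

lemma memLp_response (hπ : MemLp id 2 π) : MemLp (response X σ) 2 (jointLaw n π) :=
  (memLp_comp_fst (memLp_toEuclideanLin hπ)).add (memLp_snd.const_smul σ)

lemma integral_norm_sq_snd : ∫ ω, ‖ω.2‖ ^ 2 ∂(jointLaw n π) = n := by
  have := integral_fun_snd (μ := π) (ν := stdGaussian (EuclideanSpace ℝ (Fin n)))
    fun t => ‖t‖ ^ 2
  rw [jointLaw, this, integral_norm_sq_stdGaussian]
  simp

lemma integral_inner_snd_eq_zero {u : EuclideanSpace ℝ (Fin d) → EuclideanSpace ℝ (Fin n)}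
    (hu : MemLp u 2 π) : ∫ ω, ⟪u ω.1, ω.2⟫ ∂(jointLaw n π) = 0 := by
  have h := integrable_inner_of_memLp (memLp_comp_fst (n := n) hu) memLp_snd
  unfold jointLaw at h ⊢
  rw [integral_prod _ h]
  have h0 : ∀ θ, ∫ t, ⟪u θ, t⟫ ∂(stdGaussian (EuclideanSpace ℝ (Fin n))) = 0 := fun θ =>
    integral_strongDual_stdGaussian (innerSL ℝ (u θ))
  simp [h0]

/-- Signal and noise are uncorrelated, so their second moments add. -/
lemma integral_norm_sq_add_smul_snd
    {u : EuclideanSpace ℝ (Fin d) → EuclideanSpace ℝ (Fin n)} (hu : MemLp u 2 π) (c : ℝ) :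
    ∫ ω, ‖u ω.1 + c • ω.2‖ ^ 2 ∂(jointLaw n π) = ∫ θ, ‖u θ‖ ^ 2 ∂π + c ^ 2 * n := by
  have h1 := (memLp_comp_fst (n := n) hu)
  have h2 := memLp_snd (n := n) (π := π)
  have e : ∀ ω : EuclideanSpace ℝ (Fin d) × EuclideanSpace ℝ (Fin n), ‖u ω.1 + c • ω.2‖ ^ 2
      = ‖u ω.1‖ ^ 2 + 2 * c * ⟪u ω.1, ω.2⟫ + c ^ 2 * ‖ω.2‖ ^ 2 := fun ω => by
    rw [norm_add_sq_real, norm_smul, real_inner_smul_right, mul_pow, Real.norm_eq_abs, sq_abs]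
    ring
  have i1 := h1.norm.integrable_sq
  have i2 := (integrable_inner_of_memLp h1 h2).const_mul (2 * c)
  have i3 := h2.norm.integrable_sq.const_mul (c ^ 2)
  have i12 : Integrable (fun ω : EuclideanSpace ℝ (Fin d) × EuclideanSpace ℝ (Fin n) =>
      ‖u ω.1‖ ^ 2 + 2 * c * ⟪u ω.1, ω.2⟫) (jointLaw n π) := i1.add i2
  simp_rw [e]
  rw [integral_add i12 i3, integral_add i1 i2, integral_const_mul, integral_const_mul,
    integral_inner_snd_eq_zero hu, integral_norm_sq_snd]
  have := integral_fun_fst (μ := π) (ν := stdGaussian (EuclideanSpace ℝ (Fin n)))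
    fun θ => ‖u θ‖ ^ 2
  rw [jointLaw, this]
  simp

/-- The scores of the signal `X θ` and of the noise `σ τ` (which is `-τ / σ`) have the same
conditional expectation given `y = X θ + σ τ`: both are the score of the law of `y`, evaluated at `y`. -/
lemma integral_inner_score_add_snd_eq_zero (hσ : 0 < σ)
    {s : EuclideanSpace ℝ (Fin n) → EuclideanSpace ℝ (Fin n)}
    (hs : IsScore (π.map X.toEuclideanLin) s) (hsm : Measurable s)
    (hs2 : MemLp (fun θ => s (X.toEuclideanLin θ)) 2 π)
    {k : EuclideanSpace ℝ (Fin n) → EuclideanSpace ℝ (Fin n)}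
    (hk : MemLp k 2 (responseLaw X π σ)) :
    ∫ ω, ⟪σ • s (X.toEuclideanLin ω.1) + ω.2, k (response X σ ω)⟫ ∂(jointLaw n π) = 0 := by
  have hXm : Measurable X.toEuclideanLin := (continuous_toEuclideanLin X).measurable
  have hS := memLp_comp_fst (n := n) hs2
  have hT := memLp_snd (n := n) (π := π)
  obtain ⟨h, hh, hproj⟩ := exists_memLp_integral_inner_comp_eq
    (measurable_response (X := X) (σ := σ)) ((hS.const_smul σ).add hT)
  have hν : IsProbabilityMeasure (responseLaw X π σ) :=
    Measure.isProbabilityMeasure_map measurable_response.aemeasurable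
  have hae : ∀ᵐ y ∂(responseLaw X π σ), h y = 0 := by
    refine ae_eq_zero_of_integral_contDiff_smul_eq_zero
      (hh.integrable (by norm_num)).locallyIntegrable fun φ hφ hφc => ?_
    obtain ⟨C, hC⟩ := hφc.exists_bound_of_continuous hφ.continuous
    have hφ1 : ContDiff ℝ 1 φ := hφ.of_le (by exact_mod_cast le_top)
    refine ext_inner_left ℝ fun v => ?_
    have hk : MemLp (fun y => φ y • v) 2 (responseLaw X π σ) :=
      MemLp.of_bound (hφ.continuous.smul continuous_const).aestronglyMeasurable (C * ‖v‖)
        (.of_forall fun y => by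
          rw [norm_smul]; exact mul_le_mul_of_nonneg_right (hC y) (norm_nonneg v))
    have hφh : Integrable (fun y => φ y • h y) (responseLaw X π σ) :=
      (hh.integrable (by norm_num)).bdd_smul C hφ.continuous.aestronglyMeasurable (.of_forall hC)
    have h1 : ⟪v, ∫ y, φ y • h y ∂(responseLaw X π σ)⟫
        = ∫ ω, ⟪h (response X σ ω), φ (response X σ ω) • v⟫ ∂(jointLaw n π) := by
      rw [← integral_inner hφh, responseLaw,
        integral_map measurable_response.aemeasurable
          (aestronglyMeasurable_const.inner hφh.aestronglyMeasurable)]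
      simp_rw [real_inner_smul_right, real_inner_comm]
    rw [inner_zero_right, h1, ← hproj _ hk]
    have hb : Continuous fun y => fderiv ℝ φ y v :=
      (hφ1.continuous_fderiv (by norm_num)).clm_apply continuous_const
    obtain ⟨C', hC'⟩ := (hφc.fderiv_apply ℝ v).exists_bound_of_continuous hb
    have iD : Integrable (fun ω => fderiv ℝ φ (response X σ ω) v) (jointLaw n π) :=
      Integrable.of_bound (hb.measurable.comp measurable_response).aestronglyMeasurable C'
        (.of_forall fun ω => hC' _)
    have iS : Integrable (fun ω => φ (response X σ ω) * ⟪s (X.toEuclideanLin ω.1), v⟫)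
        (jointLaw n π) :=
      ((hS.integrable (by norm_num)).inner_const v).bdd_mul (c := C)
        (hφ.continuous.measurable.comp measurable_response).aestronglyMeasurable
        (.of_forall fun ω => hC _)
    have iT : Integrable (fun ω => φ (response X σ ω) * ⟪ω.2, v⟫) (jointLaw n π) :=
      ((hT.integrable (by norm_num)).inner_const v).bdd_mul (c := C)
        (hφ.continuous.measurable.comp measurable_response).aestronglyMeasurable
        (.of_forall fun ω => hC _)
    -- integrate by parts in the signal, with the noise fixed
    have eS : ∫ ω, φ (response X σ ω) * ⟪s (X.toEuclideanLin ω.1), v⟫ ∂(jointLaw n π)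
        = -∫ ω, fderiv ℝ φ (response X σ ω) v ∂(jointLaw n π) := by
      unfold jointLaw at iS iD ⊢
      rw [integral_prod_symm _ iS, integral_prod_symm _ iD, ← integral_neg]
      refine integral_congr_ae (.of_forall fun t => ?_)
      have h2 := hs (fun z => φ (z + σ • t)) (hφ1.comp (contDiff_id.add contDiff_const))
        (hφc.comp_homeomorph (Homeomorph.addRight (σ • t))) v
      simp only [fderiv_comp_add_right] at h2
      rw [integral_map hXm.aemeasurable, integral_map hXm.aemeasurable] at h2
      · exact h2
      · exact (hb.comp (continuous_id.add continuous_const)).aestronglyMeasurable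
      · exact ((hφ.continuous.measurable.comp (measurable_id.add_const _)).mul
          (hsm.inner measurable_const)).aestronglyMeasurable
    -- integrate by parts in the noise, with the signal fixed
    have eT : ∫ ω, φ (response X σ ω) * ⟪ω.2, v⟫ ∂(jointLaw n π)
        = σ * ∫ ω, fderiv ℝ φ (response X σ ω) v ∂(jointLaw n π) := by
      unfold jointLaw at iT iD ⊢
      rw [integral_prod _ iT, integral_prod _ iD, ← integral_const_mul]
      refine integral_congr_ae (.of_forall fun θ => ?_)
      have h2 := isScore_stdGaussian (EuclideanSpace ℝ (Fin n))
        (fun t => φ (X.toEuclideanLin θ + σ • t))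
        (hφ1.comp (contDiff_const.add (contDiff_id.const_smul σ)))
        (hφc.comp_homeomorph ((Homeomorph.smulOfNeZero σ hσ.ne').trans
          (Homeomorph.addLeft (X.toEuclideanLin θ)))) v
      have h3 : ∀ t, fderiv ℝ (fun t => φ (X.toEuclideanLin θ + σ • t)) t v
          = σ * fderiv ℝ φ (X.toEuclideanLin θ + σ • t) v := fun t => by
        have := ((hφ1.differentiable (by norm_num)) (X.toEuclideanLin θ + σ • t)).hasFDerivAt.comp
          t (((hasFDerivAt_id t).const_smul σ).const_add (X.toEuclideanLin θ))
        rw [show (fun t => φ (X.toEuclideanLin θ + σ • t))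
          = φ ∘ fun t => X.toEuclideanLin θ + σ • t from rfl]
        erw [this.fderiv]
        simp
      simp only [h3, inner_neg_left, mul_neg, integral_neg, integral_const_mul, neg_inj] at h2
      exact h2
    simp only [Pi.add_apply, Pi.smul_apply]
    have e : ∀ ω : EuclideanSpace ℝ (Fin d) × EuclideanSpace ℝ (Fin n),
        ⟪σ • s (X.toEuclideanLin ω.1) + ω.2, φ (response X σ ω) • v⟫
        = σ * (φ (response X σ ω) * ⟪s (X.toEuclideanLin ω.1), v⟫)
          + φ (response X σ ω) * ⟪ω.2, v⟫ := fun ω => by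
      rw [inner_add_left, real_inner_smul_left, real_inner_smul_right, real_inner_smul_right]
    simp_rw [e]
    rw [integral_add (iS.const_mul σ) iT, integral_const_mul, eS, eT]
    ring
  have hae' : ∀ᵐ ω ∂(jointLaw n π), h (response X σ ω) = 0 :=
    measurePreserving_response.quasiMeasurePreserving.ae hae
  exact (hproj k hk).trans (integral_eq_zero_of_ae (hae'.mono fun ω hω => by simp [hω]))

end Model

/-! ### The `Σ`-norm -/

section Weighted

variable {n d : ℕ} {S : Matrix (Fin d) (Fin d) ℝ}

open scoped MatrixOrder in
lemma sqNorm_eq_norm_sq_sqrt (hS : S.PosDef) (v : EuclideanSpace ℝ (Fin d)) :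
    sqNorm S v = ‖(CFC.sqrt S).toEuclideanLin v‖ ^ 2 := by
  have hR : (CFC.sqrt S)ᵀ = CFC.sqrt S := by
    rw [← Matrix.conjTranspose_eq_transpose_of_trivial]
    exact (Matrix.nonneg_iff_posSemidef.1 (CFC.sqrt_nonneg S)).isHermitian
  have h1 : CFC.sqrt S * CFC.sqrt S = S := CFC.sqrt_mul_sqrt_self S hS.posSemidef.nonneg
  rw [EuclideanSpace.real_norm_sq_eq, sqNorm]
  conv_lhs => rw [← h1, ← Matrix.mulVec_mulVec, Matrix.dotProduct_mulVec, ← Matrix.mulVec_transpose,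
    hR]
  simp [dotProduct, Matrix.toLpLin_apply, sq]

open scoped MatrixOrder in
/-- The comparison `(1/n) ‖X v‖² ≤ λ_Σ ‖v‖_Σ²`, up to the factor `1/n`. -/
lemma norm_sq_toEuclideanLin_le (hS : S.PosDef) (X : Matrix (Fin n) (Fin d) ℝ)
    (v : EuclideanSpace ℝ (Fin d)) :
    ‖X.toEuclideanLin v‖ ^ 2 ≤ specNorm (X * (CFC.sqrt S)⁻¹) ^ 2 * sqNorm S v := by
  have h1 : CFC.sqrt S * CFC.sqrt S = S := CFC.sqrt_mul_sqrt_self S hS.posSemidef.nonneg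
  have hdet : IsUnit (CFC.sqrt S).det := by
    have h2 : (CFC.sqrt S).det * (CFC.sqrt S).det = S.det := by rw [← Matrix.det_mul, h1]
    refine isUnit_iff_ne_zero.2 fun h0 => hS.det_pos.ne' ?_
    rw [← h2, h0, zero_mul]
  have h3 : X.toEuclideanLin v
      = (X * (CFC.sqrt S)⁻¹).toEuclideanLin ((CFC.sqrt S).toEuclideanLin v) := by
    simp only [Matrix.toLpLin_apply, Matrix.mulVec_mulVec, Matrix.mul_assoc,
      Matrix.nonsing_inv_mul _ hdet,
      Matrix.mul_one]
  rw [sqNorm_eq_norm_sq_sqrt hS, ← mul_pow, h3]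
  exact pow_le_pow_left₀ (norm_nonneg _)
    ((LinearMap.toContinuousLinearMap (X * (CFC.sqrt S)⁻¹).toEuclideanLin).le_opNorm _) 2

end Weighted

/-! ### The posterior mean and its training error -/

section PosteriorMean

variable {n d : ℕ} {X : Matrix (Fin n) (Fin d) ℝ} {π : Measure (EuclideanSpace ℝ (Fin d))}
  {σ : ℝ} {S : Matrix (Fin d) (Fin d) ℝ}
  {g h : EuclideanSpace ℝ (Fin n) → EuclideanSpace ℝ (Fin d)}

/-- `h` is the posterior mean, `h(y) = E[θ | y]`, expressed by its orthogonality relation against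
square-integrable functions of `y`. -/
def IsPosteriorMean (X : Matrix (Fin n) (Fin d) ℝ) (π : Measure (EuclideanSpace ℝ (Fin d)))
    (σ : ℝ) (h : EuclideanSpace ℝ (Fin n) → EuclideanSpace ℝ (Fin d)) : Prop :=
  IsEstimator X π σ h ∧ ∀ k : EuclideanSpace ℝ (Fin n) → EuclideanSpace ℝ (Fin d),
    MemLp k 2 (responseLaw X π σ) →
      ∫ ω, ⟪ω.1, k (response X σ ω)⟫ ∂(jointLaw n π)
        = ∫ ω, ⟪h (response X σ ω), k (response X σ ω)⟫ ∂(jointLaw n π)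

lemma trainError_eq : trainError X π σ g = (1 / (n : ℝ)) *
    ∫ ω, ‖X.toEuclideanLin (g (response X σ ω)) - response X σ ω‖ ^ 2 ∂(jointLaw n π) :=
  integral_const_mul _ _

lemma varParam_nonneg : 0 ≤ varParam X π := integral_nonneg fun θ => by positivity

lemma exists_isPosteriorMean (hπ : MemLp id 2 π) : ∃ h, IsPosteriorMean X π σ h :=
  exists_memLp_integral_inner_comp_eq measurable_response (memLp_comp_fst hπ)

lemma IsEstimator.memLp_comp_response (hg : IsEstimator X π σ g) :
    MemLp (fun ω => g (response X σ ω)) 2 (jointLaw n π) :=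
  MemLp.comp_measurePreserving hg measurePreserving_response

/-- The excess prediction error over the posterior mean (Pythagoras). -/
lemma predError_sub_predError (hS : S.PosDef) (hπ : MemLp id 2 π) (hg : IsEstimator X π σ g)
    (hh : IsPosteriorMean X π σ h) :
    predError X π σ S g - predError X π σ S h
      = ∫ ω, sqNorm S (g (response X σ ω) - h (response X σ ω)) ∂(jointLaw n π) := by
  obtain ⟨R, hR⟩ : ∃ R : EuclideanSpace ℝ (Fin d) →L[ℝ] EuclideanSpace ℝ (Fin d),
      ∀ v, sqNorm S v = ‖R v‖ ^ 2 :=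
    ⟨LinearMap.toContinuousLinearMap _, sqNorm_eq_norm_sq_sqrt hS⟩
  have mθ : MemLp (fun ω => ω.1) 2 (jointLaw n π) := memLp_comp_fst hπ
  have mg := hg.memLp_comp_response
  have mh := hh.1.memLp_comp_response
  have mgh : MemLp (fun ω => R (g (response X σ ω) - h (response X σ ω))) 2 (jointLaw n π) :=
    R.comp_memLp' (mg.sub mh)
  have mhθ : MemLp (fun ω => R (h (response X σ ω) - ω.1)) 2 (jointLaw n π) :=
    R.comp_memLp' (mh.sub mθ)
  have hk : MemLp (fun y => R.adjoint (R (g y - h y))) 2 (responseLaw X π σ) :=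
    R.adjoint.comp_memLp' (R.comp_memLp' (MemLp.sub hg hh.1))
  have hkY : MemLp (fun ω => R.adjoint (R (g (response X σ ω) - h (response X σ ω)))) 2
      (jointLaw n π) := hk.comp_measurePreserving measurePreserving_response
  have cross : ∫ ω, ⟪R (g (response X σ ω) - h (response X σ ω)), R (h (response X σ ω) - ω.1)⟫
      ∂(jointLaw n π) = 0 := by
    have e : ∀ ω : EuclideanSpace ℝ (Fin d) × EuclideanSpace ℝ (Fin n),
        ⟪R (g (response X σ ω) - h (response X σ ω)), R (h (response X σ ω) - ω.1)⟫
        = ⟪h (response X σ ω), R.adjoint (R (g (response X σ ω) - h (response X σ ω)))⟫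
          - ⟪ω.1, R.adjoint (R (g (response X σ ω) - h (response X σ ω)))⟫ := fun ω => by
      rw [← inner_sub_left, ContinuousLinearMap.adjoint_inner_right, real_inner_comm]
    simp_rw [e]
    rw [integral_sub (integrable_inner_of_memLp mh hkY) (integrable_inner_of_memLp mθ hkY),
      hh.2 _ hk, sub_self]
  have i1 := mgh.norm.integrable_sq
  have i2 := (integrable_inner_of_memLp mgh mhθ).const_mul 2
  have i3 := mhθ.norm.integrable_sq
  have i12 : Integrable (fun ω => ‖R (g (response X σ ω) - h (response X σ ω))‖ ^ 2
      + 2 * ⟪R (g (response X σ ω) - h (response X σ ω)), R (h (response X σ ω) - ω.1)⟫)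
      (jointLaw n π) := i1.add i2
  have e : ∀ ω : EuclideanSpace ℝ (Fin d) × EuclideanSpace ℝ (Fin n),
      ‖R (g (response X σ ω) - ω.1)‖ ^ 2
      = ‖R (g (response X σ ω) - h (response X σ ω))‖ ^ 2
        + 2 * ⟪R (g (response X σ ω) - h (response X σ ω)), R (h (response X σ ω) - ω.1)⟫
        + ‖R (h (response X σ ω) - ω.1)‖ ^ 2 := fun ω => by
    rw [← norm_add_sq_real, ← map_add, sub_add_sub_cancel]
  simp only [predError, hR]
  simp_rw [e]
  rw [integral_add i12 i3, integral_add i1 i2, integral_const_mul, cross]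
  ring

variable [IsProbabilityMeasure π]

lemma memLp_residual (hπ : MemLp id 2 π) (hg : IsEstimator X π σ g) :
    MemLp (fun ω => X.toEuclideanLin (g (response X σ ω)) - response X σ ω) 2 (jointLaw n π) :=
  ((LinearMap.toContinuousLinearMap X.toEuclideanLin).comp_memLp' hg.memLp_comp_response).sub
    (memLp_response hπ)

/-- Deviating from the training error of the posterior mean costs prediction error. -/
lemma mul_sq_sqrt_trainError_sub_le_cost (hS : S.PosDef) (hπ : MemLp id 2 π)
    (hg : IsEstimator X π σ g) (hh : IsPosteriorMean X π σ h) :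
    (lambda X S)⁻¹ * (√(trainError X π σ g) - √(trainError X π σ h)) ^ 2 ≤ cost X π σ S g := by
  -- the infimum defining the cost is a real `sInf`, so boundedness from below is needed
  have hbdd : BddBelow (predError X π σ S '' {g | IsEstimator X π σ g}) := by
    refine ⟨0, ?_⟩
    rintro _ ⟨g, -, rfl⟩
    exact integral_nonneg fun ω => by
      simp only [sqNorm_eq_norm_sq_sqrt hS]
      positivity
  have hopt : optPredError X π σ S ≤ predError X π σ S h := csInf_le hbdd ⟨h, hh.1, rfl⟩
  have hcost : ∫ ω, sqNorm S (g (response X σ ω) - h (response X σ ω)) ∂(jointLaw n π)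
      ≤ cost X π σ S g := by
    rw [← predError_sub_predError hS hπ hg hh, cost]
    linarith
  have hD := hg.memLp_comp_response.sub hh.1.memLp_comp_response
  have hint : Integrable (fun ω => sqNorm S (g (response X σ ω) - h (response X σ ω)))
      (jointLaw n π) := by
    simp only [sqNorm_eq_norm_sq_sqrt hS]
    exact ((LinearMap.toContinuousLinearMap _).comp_memLp' hD).norm.integrable_sq
  have hn0 : 0 ≤ 1 / (n : ℝ) := by positivity
  have h0 : 0 ≤ ∫ ω, sqNorm S (g (response X σ ω) - h (response X σ ω)) ∂(jointLaw n π) :=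
    integral_nonneg fun ω => by
      simp only [sqNorm_eq_norm_sq_sqrt hS]
      positivity
  refine le_trans (inv_mul_le_of_le_mul₀ (by unfold lambda; positivity) h0 ?_) hcost
  have htri := sq_sqrt_integral_sub_le (memLp_residual hπ hg) (memLp_residual hπ hh.1)
  rw [trainError_eq, trainError_eq, Real.sqrt_mul hn0, Real.sqrt_mul hn0, ← mul_sub, mul_pow,
    Real.sq_sqrt hn0, lambda, mul_assoc]
  refine mul_le_mul_of_nonneg_left (htri.trans ?_) hn0
  rw [← integral_const_mul]
  refine integral_mono_of_nonneg (.of_forall fun ω => by positivity) (hint.const_mul _)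
    (.of_forall fun ω => ?_)
  simp only [sub_sub_sub_cancel_right, ← map_sub]
  exact norm_sq_toEuclideanLin_le hS X _

/-- The training residual of the posterior mean is `-σ E[τ | y]`. -/
lemma integral_inner_residual (hπ : MemLp id 2 π) (hh : IsPosteriorMean X π σ h)
    {k : EuclideanSpace ℝ (Fin n) → EuclideanSpace ℝ (Fin n)}
    (hk : MemLp k 2 (responseLaw X π σ)) :
    ∫ ω, ⟪X.toEuclideanLin (h (response X σ ω)) - response X σ ω, k (response X σ ω)⟫
        ∂(jointLaw n π)
      = -σ * ∫ ω, ⟪ω.2, k (response X σ ω)⟫ ∂(jointLaw n π) := by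
  obtain ⟨A, hA⟩ : ∃ A : EuclideanSpace ℝ (Fin d) →L[ℝ] EuclideanSpace ℝ (Fin n),
      ∀ v, X.toEuclideanLin v = A v := ⟨LinearMap.toContinuousLinearMap _, fun _ => rfl⟩
  have hAk : MemLp (fun y => A.adjoint (k y)) 2 (responseLaw X π σ) := A.adjoint.comp_memLp' hk
  have hAkY := hAk.comp_measurePreserving (measurePreserving_response (X := X) (σ := σ) (π := π))
  have hkY := hk.comp_measurePreserving (measurePreserving_response (X := X) (σ := σ) (π := π))
  have mθ : MemLp (fun ω => ω.1) 2 (jointLaw n π) := memLp_comp_fst hπ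
  have hy : ∀ (ω : EuclideanSpace ℝ (Fin d) × EuclideanSpace ℝ (Fin n))
      (w : EuclideanSpace ℝ (Fin n)),
      ⟪response X σ ω, w⟫ = ⟪A ω.1, w⟫ + σ * ⟪ω.2, w⟫ := fun ω w => by
    rw [response, inner_add_left, real_inner_smul_left, hA]
  have e : ∀ ω : EuclideanSpace ℝ (Fin d) × EuclideanSpace ℝ (Fin n),
      ⟪X.toEuclideanLin (h (response X σ ω)) - response X σ ω, k (response X σ ω)⟫
      = ⟪h (response X σ ω), A.adjoint (k (response X σ ω))⟫
        - ⟪ω.1, A.adjoint (k (response X σ ω))⟫ - σ * ⟪ω.2, k (response X σ ω)⟫ := fun ω => by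
    rw [ContinuousLinearMap.adjoint_inner_right, ContinuousLinearMap.adjoint_inner_right,
      inner_sub_left, hy, hA]
    ring
  have i1 := integrable_inner_of_memLp hh.1.memLp_comp_response hAkY
  have i2 := integrable_inner_of_memLp mθ hAkY
  have i3 := (integrable_inner_of_memLp memLp_snd hkY).const_mul σ
  have i12 : Integrable (fun ω => ⟪h (response X σ ω), A.adjoint (k (response X σ ω))⟫
      - ⟪ω.1, A.adjoint (k (response X σ ω))⟫) (jointLaw n π) := i1.sub i2
  simp only [Function.comp_def] at i1 i2 i3
  simp_rw [e]
  rw [integral_sub i12 i3, integral_sub i1 i2, hh.2 _ hAk, integral_const_mul]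
  ring

/-- Cramér–Rao-type lower bound: pair the residual of the posterior mean with `y` itself. -/
lemma le_trainError_of_isPosteriorMean (hn : 1 ≤ n) (hσ : 0 < σ) (hπ : MemLp id 2 π)
    (hh : IsPosteriorMean X π σ h) :
    σ ^ 4 / (varParam X π + σ ^ 2) ≤ trainError X π σ h := by
  have hn' : (0 : ℝ) < n := by exact_mod_cast hn
  have hY := memLp_response (X := X) (σ := σ) hπ
  have hid : MemLp id 2 (responseLaw X π σ) :=
    (memLp_map_measure_iff aestronglyMeasurable_id measurable_response.aemeasurable).2 hY
  have hsig := memLp_toEuclideanLin (X := X) hπ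
  have h1 := integral_inner_residual hπ hh hid
  have h2 : ∫ ω, ⟪ω.2, response X σ ω⟫ ∂(jointLaw n π) = σ * n := by
    have e : ∀ ω : EuclideanSpace ℝ (Fin d) × EuclideanSpace ℝ (Fin n), ⟪ω.2, response X σ ω⟫
        = ⟪X.toEuclideanLin ω.1, ω.2⟫ + σ * ‖ω.2‖ ^ 2 := fun ω => by
      rw [response, inner_add_right, real_inner_smul_right, real_inner_self_eq_norm_sq,
        real_inner_comm]
    simp_rw [e]
    rw [integral_add (integrable_inner_of_memLp (memLp_comp_fst hsig) memLp_snd)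
      (memLp_snd.norm.integrable_sq.const_mul σ), integral_inner_snd_eq_zero hsig,
      integral_const_mul, integral_norm_sq_snd, zero_add]
  have h3 : ∫ ω, ‖response X σ ω‖ ^ 2 ∂(jointLaw n π) = n * (varParam X π + σ ^ 2) := by
    have := integral_norm_sq_add_smul_snd hsig σ
    have hV : ∫ θ, ‖X.toEuclideanLin θ‖ ^ 2 ∂π = n * varParam X π := by
      rw [varParam, integral_const_mul]
      field_simp
    rw [hV] at this
    unfold response
    rw [this]
    ring
  have h4 := sq_integral_inner_le (memLp_residual hπ hh.1) hY
  simp only [id] at h1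
  rw [h1, h2, h3] at h4
  have hV := varParam_nonneg (X := X) (π := π)
  rw [div_le_iff₀ (by positivity), trainError_eq]
  have hn2 : (0 : ℝ) < n ^ 2 := by positivity
  refine le_of_mul_le_mul_left ?_ hn2
  calc (n : ℝ) ^ 2 * σ ^ 4 = (-σ * (σ * n)) ^ 2 := by ring
    _ ≤ _ := h4
    _ = _ := by field_simp

/-- Blachman–Stam-type upper bound: the residual of the posterior mean is the conditional expectation
given `y` of every combination `a σ² s(Xθ) - b σ τ` with `a + b = 1`, `s = ∇ log p`. -/
lemma trainError_le_of_isPosteriorMean (hn : 1 ≤ n) (hσ : 0 < σ) (hπ : MemLp id 2 π)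
    {p : EuclideanSpace ℝ (Fin n) → ℝ} (hp_pos : ∀ y, 0 < p y) (hp_diff : Differentiable ℝ p)
    (hp : π.map X.toEuclideanLin = volume.withDensity (fun y => ENNReal.ofReal (p y)))
    (hJ : Integrable (scoreSq X p) π) (hh : IsPosteriorMean X π σ h) :
    trainError X π σ h ≤ σ ^ 4 / ((fisherInfo X π p)⁻¹ + σ ^ 2) := by
  have hn' : (0 : ℝ) < n := by exact_mod_cast hn
  set s := gradient fun y => Real.log (p y) with hs_def
  have hsm : Measurable s := measurable_gradient _
  have hXm : Measurable X.toEuclideanLin := (continuous_toEuclideanLin X).measurable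
  have hsX : AEStronglyMeasurable (fun θ => s (X.toEuclideanLin θ)) π :=
    (hsm.comp hXm).aestronglyMeasurable
  have hs2 : MemLp (fun θ => s (X.toEuclideanLin θ)) 2 π := by
    rw [memLp_two_iff_integrable_sq_norm hsX]
    refine (hJ.const_mul n).congr (.of_forall fun θ => ?_)
    simp only [scoreSq]
    field_simp
    rfl
  have hs : IsScore (π.map X.toEuclideanLin) s := by
    rw [hp]
    refine isScore_gradient_log hp_pos hp_diff ?_
    rw [← hp, integrable_map_measure hsm.aestronglyMeasurable hXm.aemeasurable]
    exact hs2.integrable (by norm_num)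
  have hJn : ∫ θ, ‖s (X.toEuclideanLin θ)‖ ^ 2 ∂π = n * fisherInfo X π p := by
    simp only [fisherInfo, scoreSq]
    rw [integral_const_mul]
    field_simp
    rfl
  have hJ0 : 0 ≤ fisherInfo X π p := integral_nonneg fun θ => by unfold scoreSq; positivity
  have hk : MemLp (fun y => X.toEuclideanLin (h y) - y) 2 (responseLaw X π σ) :=
    (memLp_map_measure_iff
      (((LinearMap.toContinuousLinearMap X.toEuclideanLin).comp_memLp' hh.1).aestronglyMeasurable.sub
        aestronglyMeasurable_id) measurable_response.aemeasurable).2 (memLp_residual hπ hh.1)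
  have hr := memLp_residual hπ hh.1
  set r := fun ω => X.toEuclideanLin (h (response X σ ω)) - response X σ ω with hr_def
  have mS := memLp_comp_fst (n := n) hs2
  have mT := memLp_snd (n := n) (π := π)
  have hres : ∫ ω, ‖r ω‖ ^ 2 ∂(jointLaw n π) = -σ * ∫ ω, ⟪ω.2, r ω⟫ ∂(jointLaw n π) := by
    rw [← integral_inner_residual hπ hh hk]
    simp_rw [real_inner_self_eq_norm_sq]
    rfl
  have hsc : σ * ∫ ω, ⟪s (X.toEuclideanLin ω.1), r ω⟫ ∂(jointLaw n π)
      + ∫ ω, ⟪ω.2, r ω⟫ ∂(jointLaw n π) = 0 := by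
    rw [← integral_inner_score_add_snd_eq_zero hσ hs hsm hs2 hk, ← integral_const_mul,
      ← integral_add ((integrable_inner_of_memLp mS hr).const_mul σ)
        (integrable_inner_of_memLp mT hr)]
    simp_rw [inner_add_left, real_inner_smul_left]
    rfl
  -- the weights `a = J⁻¹ / (J⁻¹ + σ²)` and `b = σ² / (J⁻¹ + σ²)` minimise `a² J + b² / σ²`
  -- when `J ≠ 0`; for `J = 0` the convention `0⁻¹ = 0` gives `a = 0`, `b = 1` and the bound `σ²`
  set K := (fisherInfo X π p)⁻¹ with hK_def
  have hK0 : 0 ≤ K := inv_nonneg.2 hJ0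
  have hKJ : K ^ 2 * fisherInfo X π p = K := by
    rcases eq_or_ne (fisherInfo X π p) 0 with h0 | h0
    · simp [hK_def, h0]
    · rw [hK_def]; field_simp
  have hKσ : 0 < K + σ ^ 2 := by positivity
  set a := K / (K + σ ^ 2) with ha
  set b := σ ^ 2 / (K + σ ^ 2) with hb
  have hab : a + b = 1 := by rw [ha, hb]; field_simp
  have mu := hs2.const_smul (a * σ ^ 2)
  have hu2 := integral_norm_sq_add_smul_snd (n := n) mu (-(b * σ))
  have hun : ∫ θ, ‖((a * σ ^ 2) • fun θ => s (X.toEuclideanLin θ)) θ‖ ^ 2 ∂π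
      = (a * σ ^ 2) ^ 2 * (n * fisherInfo X π p) := by
    simp only [Pi.smul_apply, norm_smul, mul_pow, Real.norm_eq_abs, sq_abs]
    rw [integral_const_mul, hJn]
  rw [hun] at hu2
  have mW : MemLp (fun ω : EuclideanSpace ℝ (Fin d) × EuclideanSpace ℝ (Fin n) =>
      ((a * σ ^ 2) • fun θ => s (X.toEuclideanLin θ)) ω.1 + (-(b * σ)) • ω.2) 2 (jointLaw n π) :=
    (memLp_comp_fst mu).add (mT.const_smul (-(b * σ)))
  have hcs := sq_integral_inner_le mW hr
  have hinner : ∫ ω, ⟪((a * σ ^ 2) • fun θ => s (X.toEuclideanLin θ)) ω.1 + (-(b * σ)) • ω.2, r ω⟫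
      ∂(jointLaw n π) = ∫ ω, ‖r ω‖ ^ 2 ∂(jointLaw n π) := by
    simp only [Pi.smul_apply, inner_add_left, real_inner_smul_left]
    rw [integral_add ((integrable_inner_of_memLp mS hr).const_mul _)
      ((integrable_inner_of_memLp mT hr).const_mul _), integral_const_mul, integral_const_mul, hres]
    linear_combination (a * σ) * hsc - σ * (∫ ω, ⟪ω.2, r ω⟫ ∂(jointLaw n π)) * hab
  rw [hinner, hu2] at hcs
  have hR0 : 0 ≤ ∫ ω, ‖r ω‖ ^ 2 ∂(jointLaw n π) := integral_nonneg fun ω => by positivity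
  have hval : (a * σ ^ 2) ^ 2 * (n * fisherInfo X π p) + (-(b * σ)) ^ 2 * n
      = n * (σ ^ 4 / (K + σ ^ 2)) := by
    have e1 : (a * σ ^ 2) ^ 2 * (n * fisherInfo X π p)
        = n * σ ^ 4 * (K ^ 2 * fisherInfo X π p) / (K + σ ^ 2) ^ 2 := by
      rw [ha]; field_simp
    rw [e1, hKJ, hb]
    field_simp
  rw [hval] at hcs
  rw [trainError_eq]
  change 1 / (n : ℝ) * ∫ ω, ‖r ω‖ ^ 2 ∂(jointLaw n π) ≤ _
  rw [one_div, inv_mul_le_iff₀ hn']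
  rcases hR0.eq_or_lt with h0 | h0
  · rw [← h0]; positivity
  · rw [sq] at hcs
    exact le_of_mul_le_mul_right hcs h0

end PosteriorMean
end BayesLinearModel

/-! ### Cost of deviating from the optimal training error -/

open BayesLinearModel in
theorem theorem2
    (n d : ℕ) (hn : 1 ≤ n) (hnd : n ≤ d)
    -- the prior: a law with finite second moment and a positive, differentiable density `f`
    (π : Measure (EuclideanSpace ℝ (Fin d))) [IsProbabilityMeasure π]
    (hπ : MemLp id 2 π)
    (f : EuclideanSpace ℝ (Fin d) → ℝ)
    (hf_pos : ∀ θ, 0 < f θ) (hf_diff : Differentiable ℝ f)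
    (hf : π = volume.withDensity (fun θ => ENNReal.ofReal (f θ)))
    -- the design matrix, of full row rank
    (X : Matrix (Fin n) (Fin d) ℝ) (hX : X.rank = n)
    -- the density `p` of `X θ`, with finite Fisher information
    (p : EuclideanSpace ℝ (Fin n) → ℝ)
    (hp_pos : ∀ y, 0 < p y) (hp_diff : Differentiable ℝ p)
    (hp : π.map X.toEuclideanLin = volume.withDensity (fun y => ENNReal.ofReal (p y)))
    (hJ : Integrable (scoreSq X p) π)
    (S : Matrix (Fin d) (Fin d) ℝ) (hS : S.PosDef)
    (σ : ℝ) (hσ : 0 < σ)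
    (g : EuclideanSpace ℝ (Fin n) → EuclideanSpace ℝ (Fin d)) (hg : IsEstimator X π σ g) :
    (σ ^ 4 / ((fisherInfo X π p)⁻¹ + σ ^ 2) ≤ trainError X π σ g →
      (lambda X S)⁻¹ *
          (√(trainError X π σ g) - √(σ ^ 4 / ((fisherInfo X π p)⁻¹ + σ ^ 2))) ^ 2
        ≤ cost X π σ S g) ∧
    (trainError X π σ g ≤ σ ^ 4 / (varParam X π + σ ^ 2) →
      (lambda X S)⁻¹ *
          (√(σ ^ 4 / (varParam X π + σ ^ 2)) - √(trainError X π σ g)) ^ 2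
        ≤ cost X π σ S g) := by
  obtain ⟨h, hh⟩ := exists_isPosteriorMean (X := X) (σ := σ) hπ
  have hcost := mul_sq_sqrt_trainError_sub_le_cost hS hπ hg hh
  have hlam : 0 ≤ (lambda X S)⁻¹ := by unfold lambda; positivity
  refine ⟨fun hT => ?_, fun hT => ?_⟩
  · have hub := trainError_le_of_isPosteriorMean hn hσ hπ hp_pos hp_diff hp hJ hh
    refine le_trans (mul_le_mul_of_nonneg_left ?_ hlam) hcost
    have h1 := Real.sqrt_le_sqrt hub
    have h2 := Real.sqrt_le_sqrt hT
    exact pow_le_pow_left₀ (by linarith) (by linarith) 2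
  · have hlb := le_trainError_of_isPosteriorMean hn hσ hπ hh
    refine le_trans (mul_le_mul_of_nonneg_left ?_ hlam) hcost
    have h1 := Real.sqrt_le_sqrt hlb
    have h2 := Real.sqrt_le_sqrt hT
    rw [sub_sq_comm (√(trainError X π σ g))]
    exact pow_le_pow_left₀ (by linarith) (by linarith) 2
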